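/- Let $(\Omega,\mathcal F)$ be a measurable space and $\mathcal P$ a non-empty set of probability measures on it. Put $c(A):=\sup_{P\in\mathcal P}P(A)$, $A\in\mathcal F$; an event $A$ is $\mathcal P$-polar if $c(A)=0$. Let $\mathfrak P_c(\Omega)$ be the set of all probability measures $Q$ on $(\Omega,\mathcal F)$ that vanish on all $\mathcal P$-polar events. Let $L^0_c$ be the space of real-valued random variables modulo equality outside a $\mathcal P$-polar event, with the order $[f]_c\preccurlyeq[g]_c$ iff $\{f>g\}$ is $\mathcal P$-polar; let $L^0_{c+}$ be its positive cone, and let $L^\infty_{c+}$ be the set of all $Z\in L^0_{c+}$ with $Z\preccurlyeq m$ for some constant $m>0$. For $Q\in\mathfrak P_c(\Omega)$ let $L^0_Q$ be the space of random variables modulo $Q$-a.s. equality and $j_Q:L^0_c\to L^0_Q$, $[f]_c\mapsto[f]_Q$. A set $\mathcal D\subset L^0_c$ is - *$\mathcal P$-sensitive* if $\mathcal D=\bigcap_{Q\in\mathfrak P_c(\Omega)}j_Q^{-1}(j_Q(\mathcal D))$; a non-empty set $\mathcal Q\subset\mathfrak P_c(\Omega)$ is a *reduction set* for $\mathcal D$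 if $\mathcal D=\bigcap_{Q\in\mathcal Q}j_Q^{-1}(j_Q(\mathcal D))$; - *solid* if either $X\in\mathcal D$, $Y\in L^0_c$, $|Y|\preccurlyeq|X|$ imply $Y\in\mathcal D$ (solid in $L^0_c$), or $\mathcal D\subset L^0_{c+}$ and $X\in\mathcal D$, $Y\in L^0_{c+}$, $Y\preccurlyeq X$ imply $Y\in\mathcal D$ (solid in $L^0_{c+}$); - *sequentially order closed* if $X\in\mathcal D$ whenever $(X_n)_{n\in\mathbb N}\subset\mathcal D$, $X\in L^0_c$, and there is a decreasing sequence $(Y_n)_{n\in\mathbb N}\subset L^0_c$ with $\inf_n Y_n=0$ and $|X_n-X|\preccurlyeq Y_n$ for all $n$. For $\mathcal C\subset L^0_{c+}$ and $\mathcal Q\subset\mathfrak P_c(\Omega)$ let $$\mathcal C^\circ_{\mathcal Q}:=\{(Q,Z)\in\mathcal Q\times L^\infty_{c+}\mid \forall X\in\mathcal C:\ E_Q[ZX]\le 1\},\qquad \mathcal C^{\circ\circ}_{\mathcal Q}:=\{X\in L^0_{c+}\mid \forall (Q,Z)\in\mathcal C^\circ_{\mathcal Q}:\ E_Q[ZX]\le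 1\},$$ and $\mathcal C^{\circ\circ}:=\mathcal C^{\circ\circ}_{\mathfrak P_c(\Omega)}$. **Corollary.** Suppose that $\mathcal C\subset L^0_{c+}$ is non-empty. 1. $\mathcal C^{\circ\circ}$ is the smallest convex, solid, sequentially order closed, $\mathcal P$-sensitive subset of $L^0_{c+}$ containing $\mathcal C$. 2. $\mathcal C=\mathcal C^{\circ\circ}$ if and only if $\mathcal C$ is convex, solid, sequentially order closed, and $\mathcal P$-sensitive. 3. If $\mathcal C$ is convex, solid, and sequentially order closed, and if $\mathcal Q\subset\mathfrak P_c(\Omega)$ is a reduction set for $\mathcal C$ (so that $\mathcal C$ is in particular $\mathcal P$-sensitive), then $\mathcal C=\mathcal C^{\circ\circ}=\mathcal C^{\circ\circ}_{\mathcal Q}$. -/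

import Mathlib

open MeasureTheory
open scoped ENNReal

noncomputable section

namespace Robust

variable {Ω : Type*} [MeasurableSpace Ω]

/-- The upper probability `c(A) = sup_{P ∈ 𝓜} P(A)` induced by a set `𝓜` of probability measures. -/
def upperProb (𝓜 : Set (ProbabilityMeasure Ω)) (A : Set Ω) : ℝ≥0∞ :=
  ⨆ P ∈ 𝓜, (P : Measure Ω) A

/-- `A` is `𝓜`-polar if `c(A) = 0`. -/
def IsPolar (𝓜 : Set (ProbabilityMeasure Ω)) (A : Set Ω) : Prop :=
  upperProb 𝓜 A = 0

theorem isPolar_iff {𝓜 : Set (ProbabilityMeasure Ω)} {A : Set Ω} :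
    IsPolar 𝓜 A ↔ ∀ P ∈ 𝓜, (P : Measure Ω) A = 0 := by
  simp [IsPolar, upperProb]

theorem IsPolar.mono {𝓜 : Set (ProbabilityMeasure Ω)} {A B : Set Ω}
    (hB : IsPolar 𝓜 B) (h : A ⊆ B) : IsPolar 𝓜 A := by
  rw [isPolar_iff] at *
  exact fun P hP => measure_mono_null h (hB P hP)

theorem IsPolar.union {𝓜 : Set (ProbabilityMeasure Ω)} {A B : Set Ω}
    (hA : IsPolar 𝓜 A) (hB : IsPolar 𝓜 B) : IsPolar 𝓜 (A ∪ B) := by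
  rw [isPolar_iff] at *
  exact fun P hP => measure_union_null (hA P hP) (hB P hP)

theorem isPolar_empty (𝓜 : Set (ProbabilityMeasure Ω)) : IsPolar 𝓜 (∅ : Set Ω) := by
  simp [isPolar_iff]

/-- The set `𝔓_c(Ω)` of the probability measures `Q ≪ 𝓜`. -/
def dominatedProbs (𝓜 : Set (ProbabilityMeasure Ω)) : Set (ProbabilityMeasure Ω) :=
  {Q | ∀ N : Set Ω, MeasurableSet N → IsPolar 𝓜 N → (Q : Measure Ω) N = 0}

variable (Ω) in
/-- The real vector space `ℒ⁰` of all real-valued random variables on `Ω`. -/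
def RandVar : Submodule ℝ (Ω → ℝ) where
  carrier := {f | Measurable f}
  add_mem' hf hg := Measurable.add hf hg
  zero_mem' := measurable_const
  smul_mem' a _ hf := Measurable.const_smul hf a

/-- The subspace `𝒩` of the random variables `f` such that `{|f| > 0}` is `𝓜`-polar. -/
def nullVar (𝓜 : Set (ProbabilityMeasure Ω)) : Submodule ℝ (RandVar Ω) where
  carrier := {f | IsPolar 𝓜 {ω | 0 < |f.1 ω|}}
  add_mem' {f g} hf hg := by
    refine (IsPolar.union hf hg).mono fun ω hω => ?_
    simp only [Set.mem_ofPred_eq, abs_pos, Set.mem_union] at hω ⊢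
    by_contra! h
    exact hω (by simp [h.1, h.2])
  zero_mem' := by simp [isPolar_empty]
  smul_mem' a f hf := by
    refine IsPolar.mono hf fun ω hω => ?_
    simp only [Set.mem_ofPred_eq, abs_pos] at hω ⊢
    intro h
    exact hω (by simp [h])

/-- The space `L⁰_c = ℒ⁰ / 𝒩` of random variables up to `𝓜`-quasi-sure equality. -/
def L0 (𝓜 : Set (ProbabilityMeasure Ω)) : Type _ := RandVar Ω ⧸ nullVar 𝓜

variable {𝓜 : Set (ProbabilityMeasure Ω)}

instance : AddCommGroup (L0 𝓜) := inferInstanceAs (AddCommGroup (RandVar Ω ⧸ nullVar 𝓜))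

instance : Module ℝ (L0 𝓜) := inferInstanceAs (Module ℝ (RandVar Ω ⧸ nullVar 𝓜))

/-- The class `[f]_c` of a random variable `f`. -/
def L0.mk (𝓜 : Set (ProbabilityMeasure Ω)) : RandVar Ω →ₗ[ℝ] L0 𝓜 := (nullVar 𝓜).mkQ

theorem L0.mk_surjective (𝓜 : Set (ProbabilityMeasure Ω)) :
    Function.Surjective (L0.mk 𝓜) := (nullVar 𝓜).mkQ_surjective

theorem L0.setoid_iff {f g : RandVar Ω} :
    (nullVar 𝓜).quotientRel f g ↔ IsPolar 𝓜 {ω | f.1 ω ≠ g.1 ω} := by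
  rw [Submodule.quotientRel_def]
  have h : {ω | f.1 ω ≠ g.1 ω} = {ω | 0 < |(f - g).1 ω|} := by
    ext ω
    simp [sub_eq_zero]
  rw [h]
  rfl

theorem L0.mk_eq_mk_iff {f g : RandVar Ω} :
    L0.mk 𝓜 f = L0.mk 𝓜 g ↔ IsPolar 𝓜 {ω | f.1 ω ≠ g.1 ω} := by
  rw [← L0.setoid_iff]
  exact Quotient.eq''

/-- The `𝓜`-quasi-sure order: `[f]_c ≼ [g]_c` if `{f > g}` is `𝓜`-polar. -/
instance : LE (L0 𝓜) where
  le X Y := Quotient.liftOn₂' X Y (fun f g => IsPolar 𝓜 {ω | g.1 ω < f.1 ω}) (by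
    have key : ∀ f g f' g' : RandVar Ω, IsPolar 𝓜 {ω | f.1 ω ≠ f'.1 ω} →
        IsPolar 𝓜 {ω | g.1 ω ≠ g'.1 ω} → IsPolar 𝓜 {ω | g.1 ω < f.1 ω} →
        IsPolar 𝓜 {ω | g'.1 ω < f'.1 ω} := by
      intro f g f' g' hf hg h
      refine ((hf.union hg).union h).mono fun ω hω => ?_
      simp only [Set.mem_ofPred_eq, Set.mem_union] at hω ⊢
      by_contra! hc
      exact absurd hω (by rw [← hc.1.1, ← hc.1.2]; exact not_lt.2 hc.2)
    intro f g f' g' hf hg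
    have hf' := L0.setoid_iff.1 hf
    have hg' := L0.setoid_iff.1 hg
    exact propext ⟨key f g f' g' hf' hg',
      key f' g' f g (by simpa only [ne_comm] using hf') (by simpa only [ne_comm] using hg')⟩)

theorem L0.mk_le_mk_iff {f g : RandVar Ω} :
    L0.mk 𝓜 f ≤ L0.mk 𝓜 g ↔ IsPolar 𝓜 {ω | g.1 ω < f.1 ω} := Iff.rfl

instance : PartialOrder (L0 𝓜) where
  le_refl X := by
    obtain ⟨f, rfl⟩ := L0.mk_surjective 𝓜 X
    simp [L0.mk_le_mk_iff, isPolar_empty]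
  le_trans X Y Z := by
    obtain ⟨f, rfl⟩ := L0.mk_surjective 𝓜 X
    obtain ⟨g, rfl⟩ := L0.mk_surjective 𝓜 Y
    obtain ⟨h, rfl⟩ := L0.mk_surjective 𝓜 Z
    simp only [L0.mk_le_mk_iff]
    intro h1 h2
    refine (h1.union h2).mono fun ω hω => ?_
    simp only [Set.mem_ofPred_eq, Set.mem_union] at hω ⊢
    by_contra! hc
    linarith [hc.1, hc.2]
  le_antisymm X Y := by
    obtain ⟨f, rfl⟩ := L0.mk_surjective 𝓜 X
    obtain ⟨g, rfl⟩ := L0.mk_surjective 𝓜 Y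
    simp only [L0.mk_le_mk_iff, L0.mk_eq_mk_iff]
    intro h1 h2
    refine (h1.union h2).mono fun ω hω => ?_
    exact (lt_or_gt_of_ne hω).symm

/-- Pointwise maximum of random variables. -/
def RandVar.max (f g : RandVar Ω) : RandVar Ω := ⟨fun ω => Max.max (f.1 ω) (g.1 ω), f.2.max g.2⟩

/-- Pointwise minimum of random variables. -/
def RandVar.min (f g : RandVar Ω) : RandVar Ω := ⟨fun ω => Min.min (f.1 ω) (g.1 ω), f.2.min g.2⟩

/-- Pointwise product of random variables. -/
def RandVar.mul (f g : RandVar Ω) : RandVar Ω := ⟨fun ω => f.1 ω * g.1 ω, Measurable.mul f.2 g.2⟩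

theorem L0.map₂_aux (op : ℝ → ℝ → ℝ) {f f' g g' : RandVar Ω}
    (hf : (nullVar 𝓜).quotientRel f f') (hg : (nullVar 𝓜).quotientRel g g') :
    IsPolar 𝓜 {ω | op (f.1 ω) (g.1 ω) ≠ op (f'.1 ω) (g'.1 ω)} := by
  refine ((L0.setoid_iff.1 hf).union (L0.setoid_iff.1 hg)).mono fun ω hω => ?_
  simp only [Set.mem_ofPred_eq, Set.mem_union] at hω ⊢
  by_contra! hc
  exact hω (by rw [hc.1, hc.2])

/-- The vector lattice structure of `L⁰_c`: `[f]_c ∨ [g]_c = [f ∨ g]_c`, `[f]_c ∧ [g]_c = [f ∧ g]_c`.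
In particular `|X| = X ∨ (-X)` is the class of the pointwise absolute value. -/
instance : Lattice (L0 𝓜) where
  sup X Y := Quotient.map₂ RandVar.max (fun _ _ hf _ _ hg =>
    L0.setoid_iff.2 (L0.map₂_aux Max.max hf hg)) X Y
  inf X Y := Quotient.map₂ RandVar.min (fun _ _ hf _ _ hg =>
    L0.setoid_iff.2 (L0.map₂_aux Min.min hf hg)) X Y
  le_sup_left X Y := by
    obtain ⟨f, rfl⟩ := L0.mk_surjective 𝓜 X
    obtain ⟨g, rfl⟩ := L0.mk_surjective 𝓜 Y
    refine (isPolar_empty 𝓜).mono fun ω hω => ?_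
    exact absurd hω (not_lt.2 (le_max_left (f.1 ω) (g.1 ω)))
  le_sup_right X Y := by
    obtain ⟨f, rfl⟩ := L0.mk_surjective 𝓜 X
    obtain ⟨g, rfl⟩ := L0.mk_surjective 𝓜 Y
    refine (isPolar_empty 𝓜).mono fun ω hω => ?_
    exact absurd hω (not_lt.2 (le_max_right (f.1 ω) (g.1 ω)))
  sup_le X Y Z := by
    obtain ⟨f, rfl⟩ := L0.mk_surjective 𝓜 X
    obtain ⟨g, rfl⟩ := L0.mk_surjective 𝓜 Y
    obtain ⟨h, rfl⟩ := L0.mk_surjective 𝓜 Z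
    intro h1 h2
    refine (IsPolar.union (L0.mk_le_mk_iff.1 h1) (L0.mk_le_mk_iff.1 h2)).mono fun ω hω => ?_
    have h3 : h.1 ω < Max.max (f.1 ω) (g.1 ω) := hω
    exact lt_max_iff.1 h3
  inf_le_left X Y := by
    obtain ⟨f, rfl⟩ := L0.mk_surjective 𝓜 X
    obtain ⟨g, rfl⟩ := L0.mk_surjective 𝓜 Y
    refine (isPolar_empty 𝓜).mono fun ω hω => ?_
    exact absurd hω (not_lt.2 (min_le_left (f.1 ω) (g.1 ω)))
  inf_le_right X Y := by
    obtain ⟨f, rfl⟩ := L0.mk_surjective 𝓜 X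
    obtain ⟨g, rfl⟩ := L0.mk_surjective 𝓜 Y
    refine (isPolar_empty 𝓜).mono fun ω hω => ?_
    exact absurd hω (not_lt.2 (min_le_right (f.1 ω) (g.1 ω)))
  le_inf X Y Z := by
    obtain ⟨f, rfl⟩ := L0.mk_surjective 𝓜 X
    obtain ⟨g, rfl⟩ := L0.mk_surjective 𝓜 Y
    obtain ⟨h, rfl⟩ := L0.mk_surjective 𝓜 Z
    intro h1 h2
    refine (IsPolar.union (L0.mk_le_mk_iff.1 h1) (L0.mk_le_mk_iff.1 h2)).mono fun ω hω => ?_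
    have h3 : Min.min (g.1 ω) (h.1 ω) < f.1 ω := hω
    exact min_lt_iff.1 h3

/-- The product of classes: `[f]_c [g]_c = [f g]_c`. -/
instance : Mul (L0 𝓜) where
  mul X Y := Quotient.map₂ RandVar.mul (fun _ _ hf _ _ hg =>
    L0.setoid_iff.2 (L0.map₂_aux (fun x y => x * y) hf hg)) X Y

theorem L0.mk_mul_mk (f g : RandVar Ω) :
    L0.mk 𝓜 f * L0.mk 𝓜 g = L0.mk 𝓜 (RandVar.mul f g) := rfl

theorem L0.mk_sup_mk (f g : RandVar Ω) :
    L0.mk 𝓜 f ⊔ L0.mk 𝓜 g = L0.mk 𝓜 (RandVar.max f g) := rfl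

/-- The class of the constant random variable `m`. -/
def L0.const (𝓜 : Set (ProbabilityMeasure Ω)) (m : ℝ) : L0 𝓜 :=
  L0.mk 𝓜 ⟨fun _ => m, measurable_const⟩

/-- The positive cone `L⁰_{c+}`. -/
def L0plus (𝓜 : Set (ProbabilityMeasure Ω)) : Set (L0 𝓜) := {X | 0 ≤ X}

/-- The positive cone `L^∞_{c+}` of the space of `𝓜`-quasi-surely bounded classes. -/
def Linftyplus (𝓜 : Set (ProbabilityMeasure Ω)) : Set (L0 𝓜) :=
  {X | (∃ m : ℝ, 0 < m ∧ |X| ≤ L0.const 𝓜 m) ∧ 0 ≤ X}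

/-- The map `j_Q : L⁰_c → L⁰_Q`, `[f]_c ↦ [f]_Q`, for `Q ∈ 𝔓_c(Ω)`. -/
def jmap (Q : dominatedProbs 𝓜) : L0 𝓜 →ₗ[ℝ] L0 {Q.1} :=
  Submodule.mapQ (nullVar 𝓜) (nullVar {Q.1}) LinearMap.id (by
    intro f hf
    refine isPolar_iff.2 fun P hP => ?_
    rw [Set.mem_singleton_iff.1 hP]
    refine Q.2 _ ?_ hf
    exact measurableSet_lt measurable_const f.2.abs)

theorem jmap_mk (Q : dominatedProbs 𝓜) (f : RandVar Ω) :
    jmap Q (L0.mk 𝓜 f) = L0.mk {Q.1} f := rfl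

/-- The expectation `E_Q[X] ∈ [0, ∞]` of a non-negative class `X` under `Q ∈ 𝔓_c(Ω)`.
It is used for `X ∈ L⁰_{c+}` only, where `ENNReal.ofReal (f ω) = f ω` holds `Q`-almost surely
for every representative `f` of `X`. -/
def expect (Q : dominatedProbs 𝓜) (X : L0 𝓜) : ℝ≥0∞ :=
  Quotient.liftOn' X (fun f : RandVar Ω => ∫⁻ ω, ENNReal.ofReal (f.1 ω) ∂(Q.1 : Measure Ω)) (by
    intro f g h
    refine lintegral_congr_ae ?_
    have h0 : (Q.1 : Measure Ω) {ω | f.1 ω ≠ g.1 ω} = 0 :=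
      Q.2 _ (measurableSet_eq_fun f.2 g.2).compl (L0.setoid_iff.1 h)
    have h1 : ∀ᵐ ω ∂(Q.1 : Measure Ω), f.1 ω = g.1 ω := h0
    filter_upwards [h1] with ω hω
    rw [hω])

theorem expect_mk (Q : dominatedProbs 𝓜) (f : RandVar Ω) :
    expect Q (L0.mk 𝓜 f) = ∫⁻ ω, ENNReal.ofReal (f.1 ω) ∂(Q.1 : Measure Ω) := rfl

/-- `𝒬 ⊆ 𝔓_c(Ω)` is a reduction set for `C`. -/
def IsReductionSet (𝒬 : Set (dominatedProbs 𝓜)) (C : Set (L0 𝓜)) : Prop :=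
  𝒬.Nonempty ∧ C = ⋂ Q ∈ 𝒬, jmap Q ⁻¹' (jmap Q '' C)

/-- `C` is `𝓜`-sensitive. -/
def IsSensitive (C : Set (L0 𝓜)) : Prop :=
  C = ⋂ Q : dominatedProbs 𝓜, jmap Q ⁻¹' (jmap Q '' C)

/-- `C` is solid in `L⁰_c`. -/
def IsSolidInL0 (C : Set (L0 𝓜)) : Prop :=
  ∀ X ∈ C, ∀ Y : L0 𝓜, |Y| ≤ |X| → Y ∈ C

/-- `C` is solid in `L⁰_{c+}`. -/
def IsSolidInL0plus (C : Set (L0 𝓜)) : Prop :=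
  C ⊆ L0plus 𝓜 ∧ ∀ X ∈ C, ∀ Y ∈ L0plus 𝓜, Y ≤ X → Y ∈ C

/-- `C` is solid if it is solid in `L⁰_c` or solid in `L⁰_{c+}`. -/
def IsSolidSet (C : Set (L0 𝓜)) : Prop :=
  IsSolidInL0 C ∨ IsSolidInL0plus C

/-- Order convergence of a sequence in `L⁰_c` with respect to the quasi-sure order. -/
def OrderConverges (X : ℕ → L0 𝓜) (x : L0 𝓜) : Prop :=
  ∃ Y : ℕ → L0 𝓜, Antitone Y ∧ IsGLB (Set.range Y) 0 ∧ ∀ n, |X n - x| ≤ Y n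

/-- `C` is sequentially order closed. -/
def IsSeqOrderClosed (C : Set (L0 𝓜)) : Prop :=
  ∀ (X : ℕ → L0 𝓜) (x : L0 𝓜), (∀ n, X n ∈ C) → OrderConverges X x → x ∈ C

/-- The polar `C°_𝒬`, the set of all `(Q, Z) ∈ 𝒬 × L^∞_{c+}` with `E_Q[Z X] ≤ 1` for all `X ∈ C`. -/
def polar (𝒬 : Set (dominatedProbs 𝓜)) (C : Set (L0 𝓜)) : Set (dominatedProbs 𝓜 × L0 𝓜) :=
  {p | p.1 ∈ 𝒬 ∧ p.2 ∈ Linftyplus 𝓜 ∧ ∀ X ∈ C, expect p.1 (p.2 * X) ≤ 1}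

/-- The bipolar `C°°_𝒬`. -/
def bipolar (𝒬 : Set (dominatedProbs 𝓜)) (C : Set (L0 𝓜)) : Set (L0 𝓜) :=
  {X | X ∈ L0plus 𝓜 ∧ ∀ p ∈ polar 𝒬 C, expect p.1 (p.2 * X) ≤ 1}

end Robust

end

/-!
The bipolar theorem in `L⁰_{c+}` is reduced to the situation of a single probability measure.

Let `C ⊆ L⁰_{c+}` be convex, solid and sequentially order closed, and let `𝒬` be a reduction set.
If `X ≥ 0` is not in `C`, then `j_Q(X) ∉ j_Q(C)` for some `Q ∈ 𝒬`. The image `j_Q(C)` is convex and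
solid, and it is closed under `Q`-almost sure limits (`jmap_mem_image_of_ae_tendsto`): on the event
where `X_n → X`, the infima `inf_{k ≥ n} X_k` belong to `C` by solidity and increase to `X`
pointwise, hence in order; the complement of this event is `Q`-null and therefore invisible to `j_Q`.

Under the single measure `Q`, `exists_bounded_separating_density` gives a bounded `Z ≥ 0` with
`E_Q[Z Y] ≤ 1` on `C` and `E_Q[Z X] > 1`. After truncating `X`, the Hahn–Banach theorem applies in
the Hilbert space `L²(Q)`, where `C` leaves a closed convex trace. Solidity allows the separating
element to be replaced by its positive part, and monotone convergence extends the bound from the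
trace to all of `C` and permits truncating the density. Hence `C = C°°_𝒬` (`bipolar_eq_self`).

Conversely every bipolar is convex, solid, sequentially order closed and sensitive. Order closedness
is Fatou's lemma, once order convergence in `L⁰_c` is known to imply almost sure convergence under
every `Q ∈ 𝔓_c(Ω)` (`ae_tendsto_of_orderConverges`). Minimality of `C°°` follows from monotonicity
of the bipolar, and the identity of `C°°` and `C°°_𝒬` from `C ⊆ C°° ⊆ C°°_𝒬 = C`.
-/

namespace Robust

open Filter Topology

/-! ### Separation under a single measure -/

/-- Separation under a single finite measure `μ`. Let `K` be a non-empty convex set of measurable,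
`μ`-a.e. non-negative functions that is solid and closed under `μ`-a.e. limits. Then every
non-negative `x ∉ K` is separated from `K` by a *bounded* non-negative density `z`. -/
theorem exists_bounded_separating_density {Ω : Type*} [MeasurableSpace Ω] (μ : Measure Ω)
    [IsFiniteMeasure μ] {K : Set (Ω → ℝ)} (hne : K.Nonempty) (hmeas : ∀ f ∈ K, Measurable f)
    (hpos : ∀ f ∈ K, ∀ᵐ ω ∂μ, 0 ≤ f ω) (hconv : Convex ℝ K)
    (hsolid : ∀ f ∈ K, ∀ g : Ω → ℝ, Measurable g → (∀ᵐ ω ∂μ, 0 ≤ g ω) →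
      (∀ᵐ ω ∂μ, g ω ≤ f ω) → g ∈ K)
    (hclosed : ∀ (F : ℕ → Ω → ℝ) (f : Ω → ℝ), (∀ n, F n ∈ K) → Measurable f →
      (∀ᵐ ω ∂μ, Tendsto (fun n => F n ω) atTop (𝓝 (f ω))) → f ∈ K)
    {x : Ω → ℝ} (hx : Measurable x) (hx0 : ∀ᵐ ω ∂μ, 0 ≤ x ω) (hxK : x ∉ K) :
    ∃ z : Ω → ℝ, Measurable z ∧ (∀ ω, 0 ≤ z ω) ∧ (∃ m : ℝ, 0 < m ∧ ∀ ω, z ω ≤ m) ∧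
      (∀ f ∈ K, ∫⁻ ω, ENNReal.ofReal (z ω * f ω) ∂μ ≤ 1) ∧
      1 < ∫⁻ ω, ENNReal.ofReal (z ω * x ω) ∂μ := by
  -- Since `x` is the limit of its truncations, one of them already lies outside `K`.
  obtain ⟨N, hN⟩ : ∃ N : ℕ, (fun ω => min (x ω) N) ∉ K := by
    by_contra! h
    refine hxK (hclosed _ x h hx (Eventually.of_forall fun ω => ?_))
    refine tendsto_const_nhds.congr' ?_
    obtain ⟨n, hn⟩ := exists_nat_ge (x ω)
    filter_upwards [eventually_ge_atTop n] with k hk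
    exact (min_eq_left (hn.trans (by exact_mod_cast hk))).symm
  set y : Ω → ℝ := fun ω => min (x ω) N with hy
  have hym : Measurable y := hx.min measurable_const
  have hy0 : ∀ᵐ ω ∂μ, 0 ≤ y ω := by
    filter_upwards [hx0] with ω h using le_min h (Nat.cast_nonneg N)
  have hyL : MemLp y 2 μ := by
    refine MemLp.of_bound hym.aestronglyMeasurable N ?_
    filter_upwards [hy0] with ω h
    rw [Real.norm_of_nonneg h]
    exact min_le_right _ _
  let A : Set (Lp ℝ 2 μ) := {a | ∃ f ∈ K, a =ᵐ[μ] f}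
  have hAconv : Convex ℝ A := by
    rintro a ⟨f, hf, haf⟩ b ⟨g, hg, hbg⟩ s t hs ht hst
    refine ⟨s • f + t • g, hconv hf hg hs ht hst, ?_⟩
    filter_upwards [haf, hbg, Lp.coeFn_add (s • a) (t • b), Lp.coeFn_smul s a,
      Lp.coeFn_smul t b] with ω h1 h2 h3 h4 h5
    exact h3.trans (by simp [Pi.add_apply, h4, h5, h1, h2])
  have hAclosed : IsClosed A := by
    refine IsSeqClosed.isClosed fun a b ha hab => ?_
    choose F hFK hF using ha
    obtain ⟨φ, -, hφ⟩ := (tendstoInMeasure_of_tendsto_Lp hab).exists_seq_tendsto_ae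
    refine ⟨b, hclosed (fun n => F (φ n)) b (fun n => hFK _)
      (Lp.stronglyMeasurable b).measurable ?_, ae_eq_rfl⟩
    have hall : ∀ᵐ ω ∂μ, ∀ n, a n ω = F n ω := ae_all_iff.2 hF
    filter_upwards [hφ, hall] with ω h1 h2
    simpa only [h2] using h1
  have hyA : hyL.toLp y ∉ A := by
    rintro ⟨f, hf, hyf⟩
    refine hN (hsolid f hf y hym hy0 ?_)
    filter_upwards [hyf, hyL.coeFn_toLp] with ω h1 h2
    exact (h2.symm.trans h1).le
  obtain ⟨φ, u, hφA, hφy⟩ := geometric_hahn_banach_closed_point hAconv hAclosed hyA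
  set ζ : Lp ℝ 2 μ := (InnerProductSpace.toDual ℝ (Lp ℝ 2 μ)).symm φ with hζ
  have hφint : ∀ (f : Ω → ℝ) (hf : MemLp f 2 μ), φ (hf.toLp f) = ∫ ω, ζ ω * f ω ∂μ := by
    intro f hf
    rw [← InnerProductSpace.toDual_symm_apply (𝕜 := ℝ) (y := φ), L2.inner_def]
    refine integral_congr_ae ?_
    filter_upwards [hf.coeFn_toLp] with ω h
    simp [h, hζ, mul_comm]
  obtain ⟨f₀, hf₀⟩ := hne
  have hu : 0 < u := by
    have h0 : (0 : Ω → ℝ) ∈ K := hsolid f₀ hf₀ 0 measurable_const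
      (Eventually.of_forall fun _ => le_rfl) (hpos f₀ hf₀)
    simpa using hφA 0 ⟨0, h0, Lp.coeFn_zero ..⟩
  have hζm : Measurable ζ := (Lp.stronglyMeasurable ζ).measurable
  let w : Ω → ℝ := fun ω => max (ζ ω) 0 / u
  have hwm : Measurable w := (hζm.max measurable_const).div_const u
  have hw0 : ∀ ω, 0 ≤ w ω := fun ω => div_nonneg (le_max_right _ _) hu.le
  have hwL : MemLp w 2 μ := by
    refine (Lp.memLp ζ).norm.const_mul u⁻¹ |>.mono hwm.aestronglyMeasurable
      (Eventually.of_forall fun ω => ?_)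
    rw [Real.norm_of_nonneg (hw0 ω), norm_mul, norm_norm, Real.norm_of_nonneg (inv_pos.2 hu).le,
      Real.norm_eq_abs, inv_mul_eq_div]
    exact div_le_div_of_nonneg_right (max_le (le_abs_self _) (abs_nonneg _)) hu.le
  have hwK : ∀ f ∈ K, ∫⁻ ω, ENNReal.ofReal (w ω * f ω) ∂μ ≤ 1 := by
    intro f hf
    have hfm := hmeas f hf
    -- Cutting `f` off outside `{ζ > 0}` stays in `K` by solidity and replaces `ζ` by `ζ⁺`.
    let g : ℕ → Ω → ℝ := fun k => {ω | 0 < ζ ω}.indicator fun ω => min (max (f ω) 0) k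
    have hgm : ∀ k, Measurable (g k) := fun k =>
      ((hfm.max measurable_const).min measurable_const).indicator
        (measurableSet_lt measurable_const hζm)
    have hg0 : ∀ k ω, 0 ≤ g k ω := fun k ω =>
      Set.indicator_nonneg (fun ω _ => le_min (le_max_right _ _) (Nat.cast_nonneg k)) ω
    have hgk : ∀ k ω, g k ω ≤ min (max (f ω) 0) k := fun k ω =>
      Set.indicator_le_self' (fun ω _ => le_min (le_max_right _ _) (Nat.cast_nonneg k)) ω
    have hgK : ∀ k, g k ∈ K := by
      refine fun k => hsolid f hf _ (hgm k) (Eventually.of_forall (hg0 k)) ?_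
      filter_upwards [hpos f hf] with ω h
      exact (hgk k ω).trans ((min_le_left _ _).trans (max_eq_left h).le)
    have hgL : ∀ k, MemLp (g k) 2 μ := fun k =>
      MemLp.of_bound (hgm k).aestronglyMeasurable k (Eventually.of_forall fun ω => by
        rw [Real.norm_of_nonneg (hg0 k ω)]
        exact (hgk k ω).trans (min_le_right _ _))
    have hbound : ∀ k, ∫⁻ ω, ENNReal.ofReal (w ω * g k ω) ∂μ ≤ 1 := by
      intro k
      have h1 : ∫ ω, ζ ω * g k ω ∂μ < u := by
        rw [← hφint _ (hgL k)]
        exact hφA _ ⟨g k, hgK k, (hgL k).coeFn_toLp⟩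
      have h2 : ∀ ω, w ω * g k ω = (ζ ω * g k ω) / u := by
        intro ω
        by_cases h : 0 < ζ ω
        · simp only [w, max_eq_left h.le]
          ring
        · simp [g, h]
      have hint : Integrable (fun ω => w ω * g k ω) μ := hwL.integrable_mul (hgL k)
      rw [← ofReal_integral_eq_lintegral_ofReal hint
        (Eventually.of_forall fun ω => mul_nonneg (hw0 ω) (hg0 k ω))]
      simp only [h2, integral_div]
      exact ENNReal.ofReal_le_one.2 ((div_le_one hu).2 h1.le)
    refine le_of_tendsto' (lintegral_tendsto_of_tendsto_of_monotone
      (fun k => (hwm.mul (hgm k)).ennreal_ofReal.aemeasurable) ?_ ?_) hbound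
    · refine Eventually.of_forall fun ω i j hij => ENNReal.ofReal_le_ofReal ?_
      refine mul_le_mul_of_nonneg_left ?_ (hw0 ω)
      exact Set.indicator_le_indicator (min_le_min_left _ (by exact_mod_cast hij))
    · filter_upwards [hpos f hf] with ω h
      refine tendsto_const_nhds.congr' ?_
      obtain ⟨n, hn⟩ := exists_nat_ge (f ω)
      filter_upwards [eventually_ge_atTop n] with k hk
      have hfk : f ω ≤ k := hn.trans (by exact_mod_cast hk)
      by_cases hz : 0 < ζ ω
      · simp [g, hz, max_eq_left h, min_eq_left hfk]
      · simp [w, max_eq_right (not_lt.1 hz)]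
  have hwy : 1 < ∫⁻ ω, ENNReal.ofReal (w ω * y ω) ∂μ := by
    have hint : Integrable (fun ω => w ω * y ω) μ := hwL.integrable_mul hyL
    rw [← ofReal_integral_eq_lintegral_ofReal hint
      (by filter_upwards [hy0] with ω h using mul_nonneg (hw0 ω) h), ENNReal.one_lt_ofReal]
    rw [hφint] at hφy
    calc (1 : ℝ) = u / u := (div_self hu.ne').symm
      _ < (∫ ω, ζ ω * y ω ∂μ) / u := (div_lt_div_iff_of_pos_right hu).2 hφy
      _ = ∫ ω, ζ ω * y ω / u ∂μ := (integral_div _ _).symm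
      _ ≤ ∫ ω, w ω * y ω ∂μ := by
        refine integral_mono_ae (((Lp.memLp ζ).integrable_mul hyL).div_const u) hint ?_
        filter_upwards [hy0] with ω h
        simp only [w]
        rw [div_mul_eq_mul_div]
        exact div_le_div_of_nonneg_right (mul_le_mul_of_nonneg_right (le_max_left _ _) h) hu.le
  -- Truncating `w` preserves the bound on `K`; at a high enough level it still separates `y`.
  obtain ⟨m, hm⟩ : ∃ m : ℕ, 1 < ∫⁻ ω, ENNReal.ofReal (min (w ω) m * y ω) ∂μ := by
    have hlim : Tendsto (fun m : ℕ => ∫⁻ ω, ENNReal.ofReal (min (w ω) m * y ω) ∂μ) atTop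
        (𝓝 (∫⁻ ω, ENNReal.ofReal (w ω * y ω) ∂μ)) := by
      refine lintegral_tendsto_of_tendsto_of_monotone
        (fun m => ((hwm.min measurable_const).mul hym).ennreal_ofReal.aemeasurable) ?_ ?_
      · filter_upwards [hy0] with ω h i j hij
        refine ENNReal.ofReal_le_ofReal (mul_le_mul_of_nonneg_right ?_ h)
        exact min_le_min_left _ (by exact_mod_cast hij)
      · refine Eventually.of_forall fun ω => tendsto_const_nhds.congr' ?_
        obtain ⟨n, hn⟩ := exists_nat_ge (w ω)
        filter_upwards [eventually_ge_atTop n] with k hk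
        rw [min_eq_left (hn.trans (by exact_mod_cast hk))]
    exact (hlim.eventually_const_lt hwy).exists
  refine ⟨fun ω => min (w ω) m, hwm.min measurable_const,
    fun ω => le_min (hw0 ω) (Nat.cast_nonneg m), ⟨m + 1, by positivity, fun ω =>
      (min_le_right _ _).trans (by linarith)⟩, fun f hf => ?_, hm.trans_le ?_⟩
  · refine (lintegral_mono_ae ?_).trans (hwK f hf)
    filter_upwards [hpos f hf] with ω h
    exact ENNReal.ofReal_le_ofReal (mul_le_mul_of_nonneg_right (min_le_left _ _) h)
  · refine lintegral_mono fun ω => ENNReal.ofReal_le_ofReal ?_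
    exact mul_le_mul_of_nonneg_left (min_le_left _ _) (le_min (hw0 ω) (Nat.cast_nonneg m))

section

variable {Ω : Type*} [MeasurableSpace Ω] {𝓜 : Set (ProbabilityMeasure Ω)}

/-! ### Quasi-sure relations through representatives -/

theorem L0.mk_le_mk_iff_ae {f g : RandVar Ω} :
    L0.mk 𝓜 f ≤ L0.mk 𝓜 g ↔ ∀ P ∈ 𝓜, ∀ᵐ ω ∂(P : Measure Ω), f.1 ω ≤ g.1 ω := by
  rw [L0.mk_le_mk_iff, isPolar_iff]
  simp only [ae_iff, not_le]

theorem L0.zero_le_mk_iff_ae {f : RandVar Ω} :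
    0 ≤ L0.mk 𝓜 f ↔ ∀ P ∈ 𝓜, ∀ᵐ ω ∂(P : Measure Ω), 0 ≤ f.1 ω := by
  rw [← map_zero (L0.mk 𝓜)]
  exact L0.mk_le_mk_iff_ae

/-- Quasi-sure domination implies `Q`-almost sure domination for every `Q ∈ 𝔓_c(Ω)`. -/
theorem L0.ae_le_of_mk_le_mk (Q : dominatedProbs 𝓜) {f g : RandVar Ω}
    (h : L0.mk 𝓜 f ≤ L0.mk 𝓜 g) : ∀ᵐ ω ∂(Q.1 : Measure Ω), f.1 ω ≤ g.1 ω := by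
  rw [ae_iff]
  simp only [not_le]
  exact Q.2 _ (measurableSet_lt g.2 f.2) (L0.mk_le_mk_iff.1 h)

theorem L0.ae_nonneg_of_zero_le_mk (Q : dominatedProbs 𝓜) {f : RandVar Ω}
    (h : 0 ≤ L0.mk 𝓜 f) : ∀ᵐ ω ∂(Q.1 : Measure Ω), 0 ≤ f.1 ω := by
  rw [← map_zero (L0.mk 𝓜)] at h
  exact L0.ae_le_of_mk_le_mk Q h

theorem L0.abs_mk (f : RandVar Ω) :
    |L0.mk 𝓜 f| = L0.mk 𝓜 ⟨fun ω => |f.1 ω|, Measurable.abs f.2⟩ := by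
  rw [abs, ← map_neg, L0.mk_sup_mk]
  rfl

theorem jmap_mk_eq_iff (Q : dominatedProbs 𝓜) {f g : RandVar Ω} :
    jmap Q (L0.mk 𝓜 f) = jmap Q (L0.mk 𝓜 g) ↔ f.1 =ᵐ[(Q.1 : Measure Ω)] g.1 := by
  rw [jmap_mk, jmap_mk, L0.mk_eq_mk_iff, isPolar_iff]
  simp only [Set.mem_singleton_iff, forall_eq, EventuallyEq, ae_iff]

/-- Every `P ∈ 𝓜` belongs to `𝔓_c(Ω)`. -/
theorem mem_dominatedProbs {P : ProbabilityMeasure Ω} (hP : P ∈ 𝓜) : P ∈ dominatedProbs 𝓜 :=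
  fun _ _ hN => isPolar_iff.1 hN P hP

theorem expect_mul_mk (Q : dominatedProbs 𝓜) (z f : RandVar Ω) :
    expect Q (L0.mk 𝓜 z * L0.mk 𝓜 f) =
      ∫⁻ ω, ENNReal.ofReal (z.1 ω * f.1 ω) ∂(Q.1 : Measure Ω) := rfl

theorem expect_mul_congr (Q : dominatedProbs 𝓜) (Z : L0 𝓜) {X Y : L0 𝓜}
    (h : jmap Q X = jmap Q Y) : expect Q (Z * X) = expect Q (Z * Y) := by
  obtain ⟨z, rfl⟩ := L0.mk_surjective 𝓜 Z
  obtain ⟨f, rfl⟩ := L0.mk_surjective 𝓜 X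
  obtain ⟨g, rfl⟩ := L0.mk_surjective 𝓜 Y
  rw [expect_mul_mk, expect_mul_mk]
  refine lintegral_congr_ae ?_
  filter_upwards [(jmap_mk_eq_iff Q).1 h] with ω hω
  rw [hω]

theorem expect_mul_mono (Q : dominatedProbs 𝓜) {Z X Y : L0 𝓜} (hZ : 0 ≤ Z) (h : X ≤ Y) :
    expect Q (Z * X) ≤ expect Q (Z * Y) := by
  obtain ⟨z, rfl⟩ := L0.mk_surjective 𝓜 Z
  obtain ⟨f, rfl⟩ := L0.mk_surjective 𝓜 X
  obtain ⟨g, rfl⟩ := L0.mk_surjective 𝓜 Y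
  rw [expect_mul_mk, expect_mul_mk]
  refine lintegral_mono_ae ?_
  filter_upwards [L0.ae_nonneg_of_zero_le_mk Q hZ, L0.ae_le_of_mk_le_mk Q h] with ω h1 h2
  exact ENNReal.ofReal_le_ofReal (mul_le_mul_of_nonneg_left h2 h1)

/-! ### Order convergence -/

/-- In `L⁰_c` a decreasing sequence with infimum `0` tends to `0` `Q`-almost surely for every
`Q ∈ 𝔓_c(Ω)`: the pointwise infimum of representatives is measurable, hence a lower bound in `L⁰_c`. -/
theorem ae_tendsto_zero_of_isGLB (Q : dominatedProbs 𝓜) {y : ℕ → RandVar Ω}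
    (hanti : Antitone fun n => L0.mk 𝓜 (y n))
    (hglb : IsGLB (Set.range fun n => L0.mk 𝓜 (y n)) 0) :
    ∀ᵐ ω ∂(Q.1 : Measure Ω), Tendsto (fun n => (y n).1 ω) atTop (𝓝 0) := by
  -- Positive parts keep the family bounded below, so that the real infimum takes no junk value.
  let g : RandVar Ω := ⟨fun ω => ⨅ n, max ((y n).1 ω) 0,
    Measurable.iInf fun n => Measurable.max (y n).2 measurable_const⟩
  have hbdd : ∀ ω, BddBelow (Set.range fun n => max ((y n).1 ω) 0) := fun ω =>
    ⟨0, by rintro _ ⟨n, rfl⟩; exact le_max_right _ _⟩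
  have hy0 : ∀ n, 0 ≤ L0.mk 𝓜 (y n) := fun n => hglb.1 ⟨n, rfl⟩
  have hg : L0.mk 𝓜 g ≤ L0.mk 𝓜 0 := by
    rw [map_zero]
    refine hglb.2 ?_
    rintro _ ⟨n, rfl⟩
    refine L0.mk_le_mk_iff_ae.2 fun P hP => ?_
    filter_upwards [L0.zero_le_mk_iff_ae.1 (hy0 n) P hP] with ω h
    exact (ciInf_le (hbdd ω) n).trans (max_eq_left h).le
  have hall0 : ∀ᵐ ω ∂(Q.1 : Measure Ω), ∀ n, 0 ≤ (y n).1 ω :=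
    ae_all_iff.2 fun n => L0.ae_nonneg_of_zero_le_mk Q (hy0 n)
  have hallanti : ∀ᵐ ω ∂(Q.1 : Measure Ω), ∀ n, (y (n + 1)).1 ω ≤ (y n).1 ω :=
    ae_all_iff.2 fun n => L0.ae_le_of_mk_le_mk Q (hanti n.le_succ)
  filter_upwards [hall0, hallanti, L0.ae_le_of_mk_le_mk Q hg] with ω h0 h1 h2
  have hinf : ⨅ n, (y n).1 ω = 0 := by
    refine le_antisymm ?_ (le_ciInf h0)
    have h3 : ⨅ n, max ((y n).1 ω) 0 ≤ 0 := h2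
    simpa only [max_eq_left (h0 _)] using h3
  rw [← hinf]
  exact tendsto_atTop_ciInf (antitone_nat_of_succ_le h1) ⟨0, by rintro _ ⟨n, rfl⟩; exact h0 n⟩

/-- Order convergence in `L⁰_c` implies `Q`-almost sure convergence for every `Q ∈ 𝔓_c(Ω)`. -/
theorem ae_tendsto_of_orderConverges (Q : dominatedProbs 𝓜) {F : ℕ → RandVar Ω} {f : RandVar Ω}
    (h : OrderConverges (fun n => L0.mk 𝓜 (F n)) (L0.mk 𝓜 f)) :
    ∀ᵐ ω ∂(Q.1 : Measure Ω), Tendsto (fun n => (F n).1 ω) atTop (𝓝 (f.1 ω)) := by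
  obtain ⟨Y, hanti, hglb, hle⟩ := h
  choose y hy using fun n => L0.mk_surjective 𝓜 (Y n)
  obtain rfl : (fun n => L0.mk 𝓜 (y n)) = Y := funext hy
  have hle' : ∀ᵐ ω ∂(Q.1 : Measure Ω), ∀ n, |(F n).1 ω - f.1 ω| ≤ (y n).1 ω := by
    refine ae_all_iff.2 fun n => ?_
    have h1 := hle n
    rw [← map_sub, L0.abs_mk] at h1
    exact L0.ae_le_of_mk_le_mk Q h1
  filter_upwards [ae_tendsto_zero_of_isGLB Q hanti hglb, hle'] with ω h1 h2
  rw [tendsto_iff_dist_tendsto_zero]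
  exact squeeze_zero (fun _ => dist_nonneg) (fun n => by simpa [Real.dist_eq] using h2 n) h1

/-- A sequence that increases pointwise everywhere to a random variable order converges. -/
theorem orderConverges_of_monotone_tendsto {F : ℕ → RandVar Ω} {f : RandVar Ω}
    (hmono : ∀ ω, Monotone fun n => (F n).1 ω)
    (hlim : ∀ ω, Tendsto (fun n => (F n).1 ω) atTop (𝓝 (f.1 ω))) :
    OrderConverges (fun n => L0.mk 𝓜 (F n)) (L0.mk 𝓜 f) := by
  have hle : ∀ n ω, (F n).1 ω ≤ f.1 ω := fun n ω => (hmono ω).ge_of_tendsto (hlim ω) n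
  refine ⟨fun n => L0.mk 𝓜 (f - F n), fun i j hij => ?_, ⟨?_, fun X hX => ?_⟩, fun n => ?_⟩
  · exact L0.mk_le_mk_iff_ae.2 fun P _ => Eventually.of_forall fun ω =>
      sub_le_sub_left (hmono ω hij) _
  · rintro _ ⟨n, rfl⟩
    exact L0.zero_le_mk_iff_ae.2 fun P _ => Eventually.of_forall fun ω =>
      sub_nonneg.2 (hle n ω)
  · obtain ⟨g, rfl⟩ := L0.mk_surjective 𝓜 X
    rw [← map_zero (L0.mk 𝓜)]
    refine L0.mk_le_mk_iff_ae.2 fun P hP => ?_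
    have hall : ∀ᵐ ω ∂(P : Measure Ω), ∀ n, g.1 ω ≤ f.1 ω - (F n).1 ω :=
      ae_all_iff.2 fun n => L0.mk_le_mk_iff_ae.1 (hX ⟨n, rfl⟩) P hP
    filter_upwards [hall] with ω h
    refine ge_of_tendsto' (x := atTop) ?_ h
    simpa using (hlim ω).const_sub (f.1 ω)
  · change |L0.mk 𝓜 (F n) - L0.mk 𝓜 f| ≤ _
    rw [← map_sub, L0.abs_mk]
    refine L0.mk_le_mk_iff_ae.2 fun P _ => Eventually.of_forall fun ω => ?_
    change |(F n).1 ω - f.1 ω| ≤ f.1 ω - (F n).1 ω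
    rw [abs_of_nonpos (sub_nonpos.2 (hle n ω)), neg_sub]

/-! ### Solid sets and their images under `j_Q` -/

/-- Within the positive cone both notions of solidity amount to solidity in `L⁰_{c+}`. -/
theorem IsSolidSet.isSolidInL0plus {C : Set (L0 𝓜)} (h : IsSolidSet C) (hpos : C ⊆ L0plus 𝓜) :
    IsSolidInL0plus C := by
  refine h.elim (fun h => ⟨hpos, fun X hX Y hY hYX => h X hX Y ?_⟩) id
  obtain ⟨f, rfl⟩ := L0.mk_surjective 𝓜 X
  obtain ⟨g, rfl⟩ := L0.mk_surjective 𝓜 Y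
  rw [L0.abs_mk, L0.abs_mk]
  refine L0.mk_le_mk_iff_ae.2 fun P hP => ?_
  filter_upwards [L0.zero_le_mk_iff_ae.1 hY P hP, L0.mk_le_mk_iff_ae.1 hYX P hP] with ω h1 h2
  exact abs_le_abs_of_nonneg h1 h2

/-- If `C ⊆ L⁰_{c+}` is solid and sequentially order closed, then `j_Q(C)` is closed under
`Q`-almost sure limits. On the convergence event the tail infima `inf_{k ≥ n} X_k` lie in `C` by
solidity and increase to the limit everywhere; off that event, which is only `Q`-null and need not
be polar, everything is set to zero. -/
theorem jmap_mem_image_of_ae_tendsto {C : Set (L0 𝓜)} (hsolid : IsSolidInL0plus C)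
    (hclosed : IsSeqOrderClosed C) (Q : dominatedProbs 𝓜) {F : ℕ → RandVar Ω} {f : RandVar Ω}
    (hF : ∀ n, L0.mk 𝓜 (F n) ∈ C)
    (hlim : ∀ᵐ ω ∂(Q.1 : Measure Ω), Tendsto (fun n => (F n).1 ω) atTop (𝓝 (f.1 ω))) :
    jmap Q (L0.mk 𝓜 f) ∈ jmap Q '' C := by
  let A : Set Ω := {ω | Tendsto (fun n => (F n).1 ω) atTop (𝓝 (f.1 ω))} ∩ ⋂ n, {ω | 0 ≤ (F n).1 ω}
  have hA : MeasurableSet A := by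
    refine MeasurableSet.inter ?_ (MeasurableSet.iInter fun n =>
      measurableSet_le measurable_const (F n).2)
    exact measurableSet_tendsto_fun (fun n => (F n).2) f.2
  have hFpos : ∀ᵐ ω ∂(Q.1 : Measure Ω), ∀ n, 0 ≤ (F n).1 ω :=
    ae_all_iff.2 fun n => L0.ae_nonneg_of_zero_le_mk Q (hsolid.1 (hF n))
  let G : ℕ → RandVar Ω := fun n =>
    ⟨A.indicator fun ω => ⨅ k, (F (n + k)).1 ω, (Measurable.iInf fun k => (F (n + k)).2).indicator hA⟩
  let g : RandVar Ω := ⟨A.indicator f.1, Measurable.indicator f.2 hA⟩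
  have hbdd : ∀ ω ∈ A, ∀ n, BddBelow (Set.range fun k => (F (n + k)).1 ω) := fun ω hω n =>
    ⟨0, by rintro _ ⟨k, rfl⟩; exact Set.mem_iInter.1 hω.2 _⟩
  have hG : ∀ n, L0.mk 𝓜 (G n) ∈ C := by
    intro n
    have hG0 : ∀ ω, 0 ≤ (G n).1 ω :=
      Set.indicator_nonneg fun ω hω => le_ciInf fun k => Set.mem_iInter.1 hω.2 (n + k)
    refine hsolid.2 _ (hF n) _ (L0.zero_le_mk_iff_ae.2 fun P _ => Eventually.of_forall hG0) ?_
    refine L0.mk_le_mk_iff_ae.2 fun P hP => ?_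
    filter_upwards [L0.zero_le_mk_iff_ae.1 (hsolid.1 (hF n)) P hP] with ω h
    change A.indicator (fun ω => ⨅ k, (F (n + k)).1 ω) ω ≤ (F n).1 ω
    exact Set.indicator_apply_le' (fun hω => ciInf_le (hbdd ω hω n) 0) fun _ => h
  have hg : L0.mk 𝓜 g ∈ C := by
    refine hclosed (fun n => L0.mk 𝓜 (G n)) _ hG (orderConverges_of_monotone_tendsto ?_ ?_)
    · intro ω i j hij
      by_cases hω : ω ∈ A
      · simp only [G, Set.indicator_of_mem hω]
        refine le_ciInf fun k => ?_
        refine (ciInf_le (hbdd ω hω i) (j - i + k)).trans_eq ?_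
        rw [show i + (j - i + k) = j + k by omega]
      · simp [G, hω]
    · intro ω
      by_cases hω : ω ∈ A
      · simp only [G, g, Set.indicator_of_mem hω]
        rw [Metric.tendsto_atTop]
        intro ε hε
        obtain ⟨N, hN⟩ := Metric.tendsto_atTop.1 hω.1 (ε / 2) (half_pos hε)
        refine ⟨N, fun n hn => ?_⟩
        rw [Real.dist_eq, abs_lt]
        have h1 : f.1 ω - ε / 2 ≤ ⨅ k, (F (n + k)).1 ω := le_ciInf fun k => by
          have := hN (n + k) (by omega)
          rw [Real.dist_eq, abs_lt] at this
          linarith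
        have h2 : ⨅ k, (F (n + k)).1 ω ≤ (F n).1 ω := ciInf_le (hbdd ω hω n) 0
        have h3 := hN n hn
        rw [Real.dist_eq, abs_lt] at h3
        constructor <;> linarith
      · simp [G, g, hω]
  refine ⟨_, hg, (jmap_mk_eq_iff Q).2 ?_⟩
  filter_upwards [hlim, hFpos] with ω h1 h2
  have hω : ω ∈ A := ⟨h1, Set.mem_iInter.2 h2⟩
  exact Set.indicator_of_mem hω _

/-! ### Separation in the robust space -/

/-- Separation in `L⁰_{c+}`: if `j_Q(X) ∉ j_Q(C)`, then some pair `(Q, Z)` in the polar of `C`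
witnesses that `X` is not in the bipolar. -/
theorem exists_separating_of_jmap_notMem {C : Set (L0 𝓜)} (hne : C.Nonempty) (hconv : Convex ℝ C)
    (hsolid : IsSolidInL0plus C) (hclosed : IsSeqOrderClosed C) (Q : dominatedProbs 𝓜) {X : L0 𝓜}
    (hX : 0 ≤ X) (hXC : jmap Q X ∉ jmap Q '' C) :
    ∃ Z ∈ Linftyplus 𝓜, (∀ Y ∈ C, expect Q (Z * Y) ≤ 1) ∧ 1 < expect Q (Z * X) := by
  obtain ⟨x, rfl⟩ := L0.mk_surjective 𝓜 X
  -- `K` consists of all `Q`-versions of elements of `C`.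
  let K : Set (Ω → ℝ) := {f | Measurable f ∧ ∃ g : RandVar Ω, L0.mk 𝓜 g ∈ C ∧
    g.1 =ᵐ[(Q.1 : Measure Ω)] f}
  have hKmem : ∀ g : RandVar Ω, L0.mk 𝓜 g ∈ C → g.1 ∈ K := fun g hg => ⟨g.2, g, hg, ae_eq_rfl⟩
  have hKne : K.Nonempty := by
    obtain ⟨Y, hY⟩ := hne
    obtain ⟨g, rfl⟩ := L0.mk_surjective 𝓜 Y
    exact ⟨_, hKmem g hY⟩
  have hKpos : ∀ f ∈ K, ∀ᵐ ω ∂(Q.1 : Measure Ω), 0 ≤ f ω := by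
    rintro f ⟨-, g, hg, hgf⟩
    filter_upwards [hgf, L0.ae_nonneg_of_zero_le_mk Q (hsolid.1 hg)] with ω h1 h2
    exact h1 ▸ h2
  have hKconv : Convex ℝ K := by
    rintro f ⟨hfm, g, hg, hgf⟩ f' ⟨hfm', g', hg', hgf'⟩ s t hs ht hst
    refine ⟨(hfm.const_smul s).add (hfm'.const_smul t), s • g + t • g', ?_, ?_⟩
    · rw [map_add, map_smul, map_smul]
      exact hconv hg hg' hs ht hst
    · exact (hgf.const_smul s).add (hgf'.const_smul t)
  have hKsolid : ∀ f ∈ K, ∀ g : Ω → ℝ, Measurable g → (∀ᵐ ω ∂(Q.1 : Measure Ω), 0 ≤ g ω) →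
      (∀ᵐ ω ∂(Q.1 : Measure Ω), g ω ≤ f ω) → g ∈ K := by
    rintro f ⟨hfm, h, hh, hhf⟩ g hgm hg0 hgf
    -- Clamping `g` between `0` and `h⁺` turns `Q`-a.s. domination into quasi-sure domination.
    let g' : RandVar Ω := ⟨fun ω => max (min (g ω) (h.1 ω)) 0,
      (Measurable.min hgm h.2).max measurable_const⟩
    refine ⟨hgm, g', hsolid.2 _ hh _ ?_ ?_, ?_⟩
    · exact L0.zero_le_mk_iff_ae.2 fun P _ => Eventually.of_forall fun ω => le_max_right _ _
    · refine L0.mk_le_mk_iff_ae.2 fun P hP => ?_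
      filter_upwards [L0.zero_le_mk_iff_ae.1 (hsolid.1 hh) P hP] with ω h0
      exact max_le (min_le_right _ _) h0
    · filter_upwards [hg0, hgf, hhf] with ω h1 h2 h3
      change max (min (g ω) (h.1 ω)) 0 = g ω
      rw [h3, min_eq_left h2, max_eq_left h1]
  have hKclosed : ∀ (F : ℕ → Ω → ℝ) (f : Ω → ℝ), (∀ n, F n ∈ K) → Measurable f →
      (∀ᵐ ω ∂(Q.1 : Measure Ω), Tendsto (fun n => F n ω) atTop (𝓝 (f ω))) → f ∈ K := by
    intro F f hF hf hlim
    choose hFm G hG hGF using hF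
    have hlim' : ∀ᵐ ω ∂(Q.1 : Measure Ω), Tendsto (fun n => (G n).1 ω) atTop (𝓝 (f ω)) := by
      filter_upwards [hlim, ae_all_iff.2 hGF] with ω h1 h2
      simpa only [h2] using h1
    obtain ⟨Y, hY, hYf⟩ := jmap_mem_image_of_ae_tendsto (f := ⟨f, hf⟩) hsolid hclosed Q hG hlim'
    obtain ⟨g, rfl⟩ := L0.mk_surjective 𝓜 Y
    exact ⟨hf, g, hY, (jmap_mk_eq_iff Q).1 hYf⟩
  have hxK : x.1 ∉ K := by
    rintro ⟨-, g, hg, hgx⟩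
    exact hXC ⟨_, hg, (jmap_mk_eq_iff Q).2 hgx⟩
  obtain ⟨z, hzm, hz0, ⟨m, hm, hzm'⟩, hzK, hzx⟩ := exists_bounded_separating_density
    (Q.1 : Measure Ω) hKne (fun f hf => hf.1) hKpos hKconv hKsolid hKclosed x.2
    (L0.ae_nonneg_of_zero_le_mk Q hX) hxK
  refine ⟨L0.mk 𝓜 ⟨z, hzm⟩, ⟨⟨m, hm, ?_⟩, ?_⟩, fun Y hY => ?_, hzx⟩
  · rw [L0.abs_mk]
    refine L0.mk_le_mk_iff_ae.2 fun P _ => Eventually.of_forall fun ω => ?_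
    exact (abs_of_nonneg (hz0 ω)).trans_le (hzm' ω)
  · exact L0.zero_le_mk_iff_ae.2 fun P _ => Eventually.of_forall hz0
  · obtain ⟨g, rfl⟩ := L0.mk_surjective 𝓜 Y
    exact hzK _ (hKmem g hY)

/-! ### The bipolar theorem -/

theorem subset_bipolar (𝒬 : Set (dominatedProbs 𝓜)) {C : Set (L0 𝓜)} (hpos : C ⊆ L0plus 𝓜) :
    C ⊆ bipolar 𝒬 C :=
  fun _ hX => ⟨hpos hX, fun _ hp => hp.2.2 _ hX⟩

theorem bipolar_mono (𝒬 : Set (dominatedProbs 𝓜)) {C D : Set (L0 𝓜)} (h : C ⊆ D) :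
    bipolar 𝒬 C ⊆ bipolar 𝒬 D :=
  fun _ hX => ⟨hX.1, fun p hp => hX.2 p ⟨hp.1, hp.2.1, fun Y hY => hp.2.2 Y (h hY)⟩⟩

theorem bipolar_anti {𝒬 𝒬' : Set (dominatedProbs 𝓜)} (h : 𝒬 ⊆ 𝒬') (C : Set (L0 𝓜)) :
    bipolar 𝒬' C ⊆ bipolar 𝒬 C :=
  fun _ hX => ⟨hX.1, fun p hp => hX.2 p ⟨h hp.1, hp.2⟩⟩

/-- The bipolar theorem in `L⁰_{c+}`, relative to a reduction set. -/
theorem bipolar_eq_self {C : Set (L0 𝓜)} (hne : C.Nonempty) (hpos : C ⊆ L0plus 𝓜)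
    (hconv : Convex ℝ C) (hsolid : IsSolidSet C) (hclosed : IsSeqOrderClosed C)
    {𝒬 : Set (dominatedProbs 𝓜)} (h𝒬 : IsReductionSet 𝒬 C) : bipolar 𝒬 C = C := by
  refine Set.Subset.antisymm (fun X hX => ?_) (subset_bipolar 𝒬 hpos)
  rw [h𝒬.2]
  refine Set.mem_iInter₂.2 fun Q hQ => ?_
  by_contra hXC
  obtain ⟨Z, hZ, hZC, hZX⟩ := exists_separating_of_jmap_notMem hne hconv
    (hsolid.isSolidInL0plus hpos) hclosed Q hX.1 hXC
  exact hZX.not_ge (hX.2 (Q, Z) ⟨hQ, hZ, hZC⟩)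

/-- `𝓜`-sensitivity means that the whole of `𝔓_c(Ω)`, non-empty since it contains `𝓜`, is a
reduction set. -/
theorem IsSensitive.isReductionSet_univ (hM : 𝓜.Nonempty) {C : Set (L0 𝓜)} (h : IsSensitive C) :
    IsReductionSet Set.univ C := by
  obtain ⟨P, hP⟩ := hM
  refine ⟨⟨⟨P, mem_dominatedProbs hP⟩, trivial⟩, ?_⟩
  simp only [Set.mem_univ, Set.iInter_true]
  exact h

/-! ### Stability properties of the bipolar -/

theorem convex_bipolar (𝒬 : Set (dominatedProbs 𝓜)) (C : Set (L0 𝓜)) :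
    Convex ℝ (bipolar 𝒬 C) := by
  rintro X hX Y hY s t hs ht hst
  obtain ⟨f, rfl⟩ := L0.mk_surjective 𝓜 X
  obtain ⟨g, rfl⟩ := L0.mk_surjective 𝓜 Y
  have hlin : s • L0.mk 𝓜 f + t • L0.mk 𝓜 g = L0.mk 𝓜 (s • f + t • g) := by
    rw [map_add, map_smul, map_smul]
  rw [hlin]
  constructor
  · refine L0.zero_le_mk_iff_ae.2 fun P hP => ?_
    filter_upwards [L0.zero_le_mk_iff_ae.1 hX.1 P hP, L0.zero_le_mk_iff_ae.1 hY.1 P hP]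
      with ω h1 h2
    exact add_nonneg (mul_nonneg hs h1) (mul_nonneg ht h2)
  · rintro ⟨Q, Z⟩ hp
    have hX' := hX.2 _ hp
    have hY' := hY.2 _ hp
    obtain ⟨z, rfl⟩ := L0.mk_surjective 𝓜 Z
    simp only [expect_mul_mk] at hX' hY' ⊢
    have hzf : Measurable fun ω => ENNReal.ofReal (z.1 ω * f.1 ω) :=
      (Measurable.mul z.2 f.2).ennreal_ofReal
    have hzg : Measurable fun ω => ENNReal.ofReal (z.1 ω * g.1 ω) :=
      (Measurable.mul z.2 g.2).ennreal_ofReal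
    calc ∫⁻ ω, ENNReal.ofReal (z.1 ω * (s • f + t • g : RandVar Ω).1 ω) ∂(Q.1 : Measure Ω)
        ≤ ∫⁻ ω, (ENNReal.ofReal s * ENNReal.ofReal (z.1 ω * f.1 ω) +
            ENNReal.ofReal t * ENNReal.ofReal (z.1 ω * g.1 ω)) ∂(Q.1 : Measure Ω) := by
          refine lintegral_mono fun ω => ?_
          rw [← ENNReal.ofReal_mul hs, ← ENNReal.ofReal_mul ht]
          refine le_of_eq_of_le (congrArg ENNReal.ofReal ?_) ENNReal.ofReal_add_le
          change z.1 ω * (s * f.1 ω + t * g.1 ω) = _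
          ring
      _ = ENNReal.ofReal s * ∫⁻ ω, ENNReal.ofReal (z.1 ω * f.1 ω) ∂(Q.1 : Measure Ω) +
            ENNReal.ofReal t * ∫⁻ ω, ENNReal.ofReal (z.1 ω * g.1 ω) ∂(Q.1 : Measure Ω) := by
          rw [lintegral_add_left (hzf.const_mul _), lintegral_const_mul _ hzf,
            lintegral_const_mul _ hzg]
      _ ≤ ENNReal.ofReal s * 1 + ENNReal.ofReal t * 1 := by gcongr
      _ = 1 := by
          rw [mul_one, mul_one, ← ENNReal.ofReal_add hs ht, hst, ENNReal.ofReal_one]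

theorem isSolidSet_bipolar (𝒬 : Set (dominatedProbs 𝓜)) (C : Set (L0 𝓜)) :
    IsSolidSet (bipolar 𝒬 C) :=
  Or.inr ⟨fun _ hX => hX.1, fun _ hX _ hY hYX => ⟨hY, fun p hp =>
    (expect_mul_mono p.1 hp.2.1.2 hYX).trans (hX.2 p hp)⟩⟩

/-- The bipolar is sequentially order closed by Fatou's lemma, order convergence being almost sure
convergence under each `Q ∈ 𝔓_c(Ω)`. -/
theorem isSeqOrderClosed_bipolar (𝒬 : Set (dominatedProbs 𝓜)) (C : Set (L0 𝓜)) :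
    IsSeqOrderClosed (bipolar 𝒬 C) := by
  intro Y X hY hYX
  choose F hF using fun n => L0.mk_surjective 𝓜 (Y n)
  obtain rfl : (fun n => L0.mk 𝓜 (F n)) = Y := funext hF
  obtain ⟨f, rfl⟩ := L0.mk_surjective 𝓜 X
  constructor
  · refine L0.zero_le_mk_iff_ae.2 fun P hP => ?_
    have hF0 : ∀ᵐ ω ∂(P : Measure Ω), ∀ n, 0 ≤ (F n).1 ω :=
      ae_all_iff.2 fun n => L0.zero_le_mk_iff_ae.1 (hY n).1 P hP
    filter_upwards [ae_tendsto_of_orderConverges ⟨P, mem_dominatedProbs hP⟩ hYX, hF0] with ω h1 h2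
    exact ge_of_tendsto' h1 h2
  · rintro ⟨Q, Z⟩ hp
    have hYp := fun n => (hY n).2 _ hp
    obtain ⟨z, rfl⟩ := L0.mk_surjective 𝓜 Z
    simp only [expect_mul_mk] at hYp ⊢
    calc ∫⁻ ω, ENNReal.ofReal (z.1 ω * f.1 ω) ∂(Q.1 : Measure Ω)
        = ∫⁻ ω, liminf (fun n => ENNReal.ofReal (z.1 ω * (F n).1 ω)) atTop
            ∂(Q.1 : Measure Ω) := by
          refine lintegral_congr_ae ?_
          filter_upwards [ae_tendsto_of_orderConverges Q hYX] with ω h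
          exact (ENNReal.tendsto_ofReal (h.const_mul _)).liminf_eq.symm
      _ ≤ liminf (fun n => ∫⁻ ω, ENNReal.ofReal (z.1 ω * (F n).1 ω) ∂(Q.1 : Measure Ω)) atTop :=
          lintegral_liminf_le fun n => (Measurable.mul z.2 (F n).2).ennreal_ofReal
      _ ≤ liminf (fun _ : ℕ => (1 : ℝ≥0∞)) atTop :=
          liminf_le_liminf (Eventually.of_forall hYp)
      _ = 1 := liminf_const _

/-- Membership in the bipolar can be tested under each `Q ∈ 𝔓_c(Ω)` separately: the expectations
depend on `j_Q(X)` only, and positivity needs to be checked only under the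
elements of `𝓜`. -/
theorem isSensitive_bipolar (𝒬 : Set (dominatedProbs 𝓜)) (C : Set (L0 𝓜)) :
    IsSensitive (bipolar 𝒬 C) := by
  refine Set.Subset.antisymm
    (Set.subset_iInter fun Q => Set.subset_preimage_image (jmap Q) _) fun X hX => ?_
  rw [Set.mem_iInter] at hX
  constructor
  · obtain ⟨f, rfl⟩ := L0.mk_surjective 𝓜 X
    refine L0.zero_le_mk_iff_ae.2 fun P hP => ?_
    obtain ⟨Y, hY, hYX⟩ := hX ⟨P, mem_dominatedProbs hP⟩
    obtain ⟨g, rfl⟩ := L0.mk_surjective 𝓜 Y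
    filter_upwards [(jmap_mk_eq_iff _).1 hYX, L0.zero_le_mk_iff_ae.1 hY.1 P hP] with ω h1 h2
    exact h1 ▸ h2
  · intro p hp
    obtain ⟨Y, hY, hYX⟩ := hX p.1
    exact (expect_mul_congr p.1 p.2 hYX).symm.trans_le (hY.2 p hp)

end

end Robust

theorem mainTheorem2 {Ω : Type*} [MeasurableSpace Ω]
    (𝓜 : Set (MeasureTheory.ProbabilityMeasure Ω)) (hM : 𝓜.Nonempty)
    (C : Set (Robust.L0 𝓜)) (hC : C.Nonempty) (hCpos : C ⊆ Robust.L0plus 𝓜) :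
    IsLeast {D : Set (Robust.L0 𝓜) | D ⊆ Robust.L0plus 𝓜 ∧ C ⊆ D ∧ Convex ℝ D ∧
        Robust.IsSolidSet D ∧ Robust.IsSeqOrderClosed D ∧ Robust.IsSensitive D}
      (Robust.bipolar Set.univ C) ∧
    (C = Robust.bipolar Set.univ C ↔
      Convex ℝ C ∧ Robust.IsSolidSet C ∧ Robust.IsSeqOrderClosed C ∧ Robust.IsSensitive C) ∧
    (Convex ℝ C → Robust.IsSolidSet C → Robust.IsSeqOrderClosed C →
      ∀ 𝒬 : Set (Robust.dominatedProbs 𝓜), Robust.IsReductionSet 𝒬 C →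
        C = Robust.bipolar Set.univ C ∧
          Robust.bipolar Set.univ C = Robust.bipolar 𝒬 C) := by
  refine ⟨⟨⟨fun X hX => hX.1, Robust.subset_bipolar _ hCpos, Robust.convex_bipolar _ C,
    Robust.isSolidSet_bipolar _ C, Robust.isSeqOrderClosed_bipolar _ C,
    Robust.isSensitive_bipolar _ C⟩, ?_⟩, ⟨fun h => ?_, ?_⟩, ?_⟩
  · rintro D ⟨hDpos, hCD, hconv, hsolid, hclosed, hsens⟩
    exact (Robust.bipolar_mono _ hCD).trans (Robust.bipolar_eq_self (hC.mono hCD) hDpos hconv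
      hsolid hclosed (hsens.isReductionSet_univ hM)).subset
  · rw [h]
    exact ⟨Robust.convex_bipolar _ C, Robust.isSolidSet_bipolar _ C,
      Robust.isSeqOrderClosed_bipolar _ C, Robust.isSensitive_bipolar _ C⟩
  · rintro ⟨hconv, hsolid, hclosed, hsens⟩
    exact (Robust.bipolar_eq_self hC hCpos hconv hsolid hclosed
      (hsens.isReductionSet_univ hM)).symm
  · intro hconv hsolid hclosed 𝒬 h𝒬
    have h1 : Robust.bipolar 𝒬 C = C :=
      Robust.bipolar_eq_self hC hCpos hconv hsolid hclosed h𝒬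
    have h2 : C = Robust.bipolar Set.univ C := by
      refine (Robust.subset_bipolar _ hCpos).antisymm ?_
      exact (Robust.bipolar_anti (Set.subset_univ 𝒬) C).trans h1.subset
    exact ⟨h2, h2.symm.trans h1.symm⟩
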